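/- Let $\mathbb K$ be a field of characteristic zero, let $V$ be a finite-dimensional $\mathbb K$-vector space of dimension $r\ge 1$ and $U=V^*$, and let $X=(x_1,\dots,x_N)$ be a finite sequence of elements of $U$ that spans $U$. Write $Y\subseteq X$ for subsequences; $\operatorname{rank}(Y)=\dim\operatorname{span}(Y)$, $\operatorname{clos}(Y)=\{x\in X:\operatorname{rank}(Y\cup x)=\operatorname{rank}(Y)\}$, and $C\subseteq X$ is a flat if $C=\operatorname{clos}(C)$. Let $\mathcal L(X)$ be the lattice of flats, ordered by inclusion, let $J\subseteq\mathcal L(X)$ be a non-empty upper set, and put $\chi_J(A)=1$ if $\operatorname{clos}(A)\in J$ and $\chi_J(A)=0$ otherwise, for $A\subseteq X$. For $x\in U$ let $p_x$ be its image in $\operatorname{Sym}(U)$ and $p_Y=\prod_{x\in Y}p_x$. For an integer $k\ge 0$ let $$\mathcal P(X,k,J)=\operatorname{span}\{\,f\,p_Y : Y\subseteq X,\ f\in\operatorname{Sym}(U),\ 0\le\deg f\le\chi_J(X\setminus Y)+k-1\,\}\subseteq\operatorname{Sym}(U).$$ For an integer $k\ge -1$ let $\mathcal I(X,k,J)\subseteq\operatorname{Sym}(V)$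 be the ideal generated by $D_\eta^{\,m(\eta)+k+\chi_J(\{x\in X:\eta(x)=0\})}$, $\eta\in V\setminus\{0\}$, where $D_\eta$ is the image of $\eta$ in $\operatorname{Sym}(V)$ and $m(\eta)$ is the number of elements $x$ of the sequence $X$ with $\eta(x)\ne0$. For an ideal $\mathcal I\subseteq \operatorname{Sym}(V)$ let $\ker\mathcal I=\{f\in\operatorname{Sym}(U):\langle f,q\rangle=0\text{ for all }q\in\mathcal I\}$, where $\langle f,q\rangle$ is the degree zero component of $q\cdot f$ and $\operatorname{Sym}(V)$ acts on $\operatorname{Sym}(U)$ by differential operators, $\eta\in V$ acting as the derivation $u\mapsto\eta(u)$ ($u\in U$). The Hilbert series of a graded subspace $W\subseteq\operatorname{Sym}(U)$ is $\operatorname{Hilb}(W,t)=\sum_{i\ge0}\dim(W\cap\operatorname{Sym}^i(U))\,t^i$. Let $x\in X$ be a coloop, that is, $\operatorname{rank}(X\setminus x)=r-1$. Let $X/x$ be the sequence of the images in $U/\mathbb Kx$ of the elements of $X\setminus x$ (if $r=1$, then $U/\mathbb Kx=0$ and the definitions above are read verbatim). For $C\subseteq X\setminus x$ let $\bar C\subseteq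 X/x$ be the subsequence with the same index set, and put $$J/x=\{\overline{C\setminus x}: x\in C\in J\},\qquad \widehat{J/x}=\{\bar C: x\notin C\in J\}\cup\{\overline{X\setminus x}\}.$$ **Theorem.** For every integer $k\ge 0$, $$\operatorname{Hilb}(\mathcal P(X,k,J),t)=\operatorname{Hilb}(\mathcal P(X/x,k,J/x),t)+\sum_{j=0}^{k-\varepsilon}t^{j+1}\operatorname{Hilb}(\mathcal P(X/x,k-j,\widehat{J/x}),t),$$ where $\varepsilon=0$ if $X\setminus x\in J$ and $\varepsilon=1$ if $X\setminus x\notin J$ (for $k=0$, $\varepsilon=1$ the sum is empty). For $k=-1$, $$\operatorname{Hilb}(\ker\mathcal I(X,-1,J),t)=\begin{cases}\operatorname{Hilb}(\ker\mathcal I(X/x,-1,J/x),t)&\text{if }X\setminus x\in J,\\ 0&\text{if }X\setminus x\notin J.\end{cases}$$ Both formulas hold for every non-empty upper set $J\subseteq\mathcal L(X)$. -/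

import Mathlib

noncomputable section

namespace Zonotopal

/-! ### The symmetric algebra, its grading and the action of differential operators -/

section Sym

variable (K : Type*) [Field K] (U : Type*) [AddCommGroup U] [Module K U]

/-- The homogeneous part of degree `i` of `Sym(U)`: the span of the products of `i` elements
of `U`. -/
def symGr (i : ℕ) : Submodule K (SymmetricAlgebra K U) :=
  LinearMap.range (SymmetricAlgebra.ι K U) ^ i

/-- The elements of `Sym(U)` of degree strictly less than `n` (zero included). -/
def symDegLT (n : ℕ) : Submodule K (SymmetricAlgebra K U) :=
  ⨆ i : Fin n, symGr K U i

variable {K U}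

/-- The Hilbert series `∑ dim (W_i) t ^ i` of a graded subspace `W` of `Sym(U)`, where
`W_i = W ∩ Sym(U)_i`. -/
def hilb (W : Submodule K (SymmetricAlgebra K U)) : PowerSeries ℕ :=
  PowerSeries.mk fun i => Module.finrank K (W ⊓ symGr K U i : Submodule K (SymmetricAlgebra K U))

/-- The algebra homomorphism `f ↦ f + ε D_v f` to the dual numbers over `Sym(U)`. -/
def taylorOne (v : Module.Dual K U) :
    SymmetricAlgebra K U →ₐ[K] TrivSqZeroExt (SymmetricAlgebra K U) (SymmetricAlgebra K U) :=
  SymmetricAlgebra.lift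
    ((TrivSqZeroExt.inlAlgHom K (SymmetricAlgebra K U) (SymmetricAlgebra K U)).toLinearMap ∘ₗ
        SymmetricAlgebra.ι K U +
      (TrivSqZeroExt.inrHom (SymmetricAlgebra K U) (SymmetricAlgebra K U)).restrictScalars K ∘ₗ
        Algebra.linearMap K (SymmetricAlgebra K U) ∘ₗ v)

theorem taylorOne_ι (v : Module.Dual K U) (u : U) :
    taylorOne v (SymmetricAlgebra.ι K U u) =
      TrivSqZeroExt.inl (SymmetricAlgebra.ι K U u) +
        TrivSqZeroExt.inr (algebraMap K (SymmetricAlgebra K U) (v u)) := by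
  simp [taylorOne]

theorem fst_taylorOne (v : Module.Dual K U) (f : SymmetricAlgebra K U) :
    (taylorOne v f).fst = f := by
  have h : (TrivSqZeroExt.fstHom K (SymmetricAlgebra K U) (SymmetricAlgebra K U)).comp
      (taylorOne v) = AlgHom.id K _ := by
    apply SymmetricAlgebra.algHom_ext
    ext u
    simp [taylorOne_ι]
  exact congrArg (fun g => g f) h

/-- The directional derivative `D_v` on `Sym(U)` for `v ∈ U*`. -/
def dirDeriv (v : Module.Dual K U) :
    Derivation K (SymmetricAlgebra K U) (SymmetricAlgebra K U) :=
  Derivation.mk'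
    ((TrivSqZeroExt.sndHom (SymmetricAlgebra K U) (SymmetricAlgebra K U)).restrictScalars K ∘ₗ
      (taylorOne v).toLinearMap)
    (by
      intro a b
      simp [fst_taylorOne, mul_comm])

/-- `D_v` is the derivation with `D_v u = v(u)` for `u ∈ U`. -/
theorem dirDeriv_ι (v : Module.Dual K U) (u : U) :
    dirDeriv v (SymmetricAlgebra.ι K U u) = algebraMap K (SymmetricAlgebra K U) (v u) := by
  simp [dirDeriv, taylorOne_ι, Algebra.algebraMap_eq_smul_one]

theorem derivation_ext {D E : Derivation K (SymmetricAlgebra K U) (SymmetricAlgebra K U)}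
    (h : ∀ u, D (SymmetricAlgebra.ι K U u) = E (SymmetricAlgebra.ι K U u)) : D = E := by
  ext f
  induction f using SymmetricAlgebra.induction with
  | algebraMap r => simp
  | ι u => exact h u
  | mul a b ha hb => simp [ha, hb]
  | add a b ha hb => simp [ha, hb]

theorem dirDeriv_commute (v w : Module.Dual K U) :
    (dirDeriv v).toLinearMap * (dirDeriv w).toLinearMap =
      ((dirDeriv w).toLinearMap * (dirDeriv v).toLinearMap :
        Module.End K (SymmetricAlgebra K U)) := by
  have h : ⁅dirDeriv v, dirDeriv w⁆ = 0 := by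
    apply derivation_ext
    intro u
    simp [Derivation.commutator_apply, dirDeriv_ι]
  ext f
  have h2 := congrArg (fun D => D f) h
  simpa [Derivation.commutator_apply, sub_eq_zero] using h2

/-- The linear map `v ↦ D_v`. -/
def dirDerivHom : Module.Dual K U →ₗ[K] Module.End K (SymmetricAlgebra K U) where
  toFun v := (dirDeriv v).toLinearMap
  map_add' v w := by
    have h : dirDeriv (v + w) = dirDeriv v + dirDeriv w :=
      derivation_ext fun u => by simp [dirDeriv_ι]
    rw [h]; rfl
  map_smul' c v := by
    have h : dirDeriv (c • v) = c • dirDeriv v :=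
      derivation_ext fun u => by simp [dirDeriv_ι, Algebra.smul_def]
    rw [h]; rfl

theorem exists_diffOp : ∃ Φ : SymmetricAlgebra K (Module.Dual K U) →ₐ[K]
    Module.End K (SymmetricAlgebra K U), ∀ v,
      Φ (SymmetricAlgebra.ι K (Module.Dual K U) v) = (dirDeriv v).toLinearMap := by
  let A := Algebra.adjoin K (Set.range (dirDerivHom (K := K) (U := U)))
  have hA : IsMulCommutative A := Algebra.isMulCommutative_adjoin K (by
    rintro _ ⟨v, rfl⟩ _ ⟨w, rfl⟩
    exact dirDeriv_commute v w)
  let : CommSemiring A := { A.toSemiring with mul_comm := hA.is_comm.comm }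
  let L : Module.Dual K U →ₗ[K] A :=
    LinearMap.codRestrict A.toSubmodule (dirDerivHom (K := K) (U := U))
      (fun v => Algebra.subset_adjoin ⟨v, rfl⟩)
  refine ⟨A.val.comp (SymmetricAlgebra.lift L), fun v => ?_⟩
  simp only [AlgHom.comp_apply, SymmetricAlgebra.lift_ι_apply]
  rfl

/-- The action of `Sym(V)`, `V = U*`, on `Sym(U)` by differential operators:
`v₁ ⋯ v_s` acts as `D_{v₁} ∘ ⋯ ∘ D_{v_s}`. -/
def diffOp : SymmetricAlgebra K (Module.Dual K U) →ₐ[K] Module.End K (SymmetricAlgebra K U) :=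
  exists_diffOp.choose

/-- This determines `diffOp`, since `V` generates the algebra `Sym(V)`. -/
theorem diffOp_ι (v : Module.Dual K U) :
    diffOp (SymmetricAlgebra.ι K (Module.Dual K U) v) = (dirDeriv v).toLinearMap :=
  exists_diffOp.choose_spec v

/-- The pairing `⟨f, q⟩`: the degree zero component of `q · f`, where `q ∈ Sym(V)` acts on
`f ∈ Sym(U)` as a differential operator. -/
def pairing (f : SymmetricAlgebra K U) (q : SymmetricAlgebra K (Module.Dual K U)) : K :=
  SymmetricAlgebra.algebraMapInv (diffOp q f)

/-- The kernel (inverse system) of an ideal `I` of `Sym(V)`. -/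
def idealKer (I : Ideal (SymmetricAlgebra K (Module.Dual K U))) :
    Submodule K (SymmetricAlgebra K U) where
  carrier := {f | ∀ q ∈ I, pairing f q = 0}
  add_mem' := by
    intro f g hf hg q hq
    have h1 := hf q hq
    have h2 := hg q hq
    simp only [pairing] at h1 h2 ⊢
    rw [map_add, map_add, h1, h2, add_zero]
  zero_mem' := by
    intro q _
    simp [pairing]
  smul_mem' := by
    intro c f hf q hq
    have h1 := hf q hq
    simp only [pairing] at h1 ⊢
    rw [map_smul, map_smul, h1, smul_zero]

end Sym

/-! ### The matroid of a finite sequence of vectors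

A sequence is a family `X : ι → U` over a finite index type; subsequences are sets of indices. -/

section Matroid

variable (K : Type*) [Field K] {U : Type*} [AddCommGroup U] [Module K U] {ι : Type*}

/-- The rank of a subsequence. -/
def rank (X : ι → U) (Y : Set ι) : ℕ :=
  Module.finrank K (Submodule.span K (X '' Y))

/-- The closure of a subsequence. -/
def clos (X : ι → U) (Y : Set ι) : Set ι :=
  {i | rank K X (insert i Y) = rank K X Y}

/-- The set of flats. -/
def flats (X : ι → U) : Set (Set ι) :=
  {C | clos K X C = C}

/-- `J` is an upper set in the lattice of flats (ordered by inclusion). -/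
structure IsUpperSetOfFlats (X : ι → U) (J : Set (Set ι)) : Prop where
  subset_flats : J ⊆ flats K X
  upward : ∀ C ∈ J, ∀ D ∈ flats K X, C ⊆ D → D ∈ J

/-- The element with index `e` is a coloop: deleting it lowers the rank `dim U` by one. -/
def IsColoop (X : ι → U) (e : ι) : Prop :=
  rank K X {e}ᶜ + 1 = Module.finrank K U

open Classical in
/-- The indicator function of `J`, extended to all subsequences by `χ(A) = χ(clos A)`. -/
def chi (X : ι → U) (J : Set (Set ι)) (A : Set ι) : ℕ :=
  if clos K X A ∈ J then 1 else 0

/-- The contraction `X/x`, where `x = X e`: the images in `U/x` of the other elements. -/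
def contract (X : ι → U) (e : ι) : {i // i ≠ e} → U ⧸ Submodule.span K {X e} :=
  fun i => Submodule.Quotient.mk (X i)

/-- `J/x`: the sets `C ∖ x` for `x ∈ C ∈ J`. -/
def contractJ (J : Set (Set ι)) (e : ι) : Set (Set {i // i ≠ e}) :=
  {D | ∃ C ∈ J, e ∈ C ∧ D = Subtype.val ⁻¹' C}

/-- The modified upper set: the sets `C ∈ J` with `x ∉ C`, together with `X ∖ x`, both viewed
in `X/x`. -/
def contractHatJ (J : Set (Set ι)) (e : ι) : Set (Set {i // i ≠ e}) :=
  {D | ∃ C ∈ J, e ∉ C ∧ D = Subtype.val ⁻¹' C} ∪ {Set.univ}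

end Matroid

/-! ### Hierarchical zonotopal power ideals and `P`-spaces -/

section Spaces

variable (K : Type*) [Field K] {U : Type*} [AddCommGroup U] [Module K U] {ι : Type*}

/-- The power ideal `I(X, k, J)`, generated by `D_η ^ (m(η) + k + χ(η))` for `η ∈ V ∖ {0}`; here
`m(η)` is the number of elements of `X` at which `η` does not vanish. If `X` spans `U` and
`k ≥ -1`, the exponent is never negative. -/
def powerIdeal (X : ι → U) (k : ℤ) (J : Set (Set ι)) :
    Ideal (SymmetricAlgebra K (Module.Dual K U)) :=
  Ideal.span {q | ∃ η : Module.Dual K U, η ≠ 0 ∧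
    q = SymmetricAlgebra.ι K (Module.Dual K U) η ^
      (({i | η (X i) ≠ 0}.ncard : ℤ) + k + (chi K X J {i | η (X i) = 0} : ℤ)).toNat}

/-- `p_Y`, the product of the elements of the subsequence `Y` in `Sym(U)`. -/
def prodP (X : ι → U) (Y : Finset ι) : SymmetricAlgebra K U :=
  ∏ i ∈ Y, SymmetricAlgebra.ι K U (X i)

/-- The space `P(X, k, J)` for `k ≥ 0`, spanned by the `f p_Y` with `Y ⊆ X` and
`deg f ≤ χ(X ∖ Y) + k - 1`. For `k = 0` this means that `f` is constant and that
`clos (X ∖ Y) ∈ J` unless `f = 0`. -/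
def pSpace (X : ι → U) (k : ℕ) (J : Set (Set ι)) : Submodule K (SymmetricAlgebra K U) :=
  Submodule.span K {g | ∃ (Y : Finset ι) (f : SymmetricAlgebra K U),
    f ∈ symDegLT K U (k + chi K X J (Y : Set ι)ᶜ) ∧ g = f * prodP K X Y}

end Spaces

end Zonotopal

end

/-! A coloop `x` admits a linear form `η` with `η(x) = 1` that vanishes on all other vectors of `X`.
Hence `U = Kx ⊕ U'` with `U' = ker η ≅ U/x`, the other vectors lie in `U'`, and `Sym(U)` is the
polynomial ring `Sym(U')[x]` (`LineSplitting`, `toPoly`).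

For `k ≥ 0` the space `P` is the direct sum of its coefficient spaces for the powers of `x`
(`mem_pWeighted_iff`). A product `p_Y` with `x ∉ Y` lies in `Sym(U')`, and adding `x` to `Y`
multiplies it by `x`. If `d(Y)` is the strict bound on `deg f`, the coefficients of `x ^ 0` form the
space with weight `d(Y)`, and those of `x ^ (j+1)` the space with weight `d(Y ∪ x) - j`. Multiples
of `p_Y` with `x ∉ Y` give nothing more in positive powers, because `d(Y) ≤ d(Y ∪ x) + 1`. It
remains to identify the weights: flats containing `x` give `J/x`, flats avoiding `x` give the
modified upper set. If `X ∖ x ∉ J`, no flat avoiding `x` is in `J`, the modified set is just the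
ground set, and the additional degree it allows is redundant as long as `k - j ≥ 1`
(`pSpace_eq_of_subset`).

For `k = -1` the generator attached to `η` is `D_η ^ χ(X ∖ x)`. If the exponent is 0, the ideal is
everything and its kernel is zero. If it is 1, the kernel consists of `f` with `D_η f = 0`, so in
characteristic zero it lies in `Sym(U')`, where it is the kernel of the restricted ideal
(`idealKer_eq_map`). That ideal is the power ideal of `X/x` (`map_powerIdeal`). -/

noncomputable section

namespace Zonotopal

open Polynomial SymmetricAlgebra

/-! ### Homogeneous components of the symmetric algebra -/

section Grading

variable {K : Type*} [Field K] {U : Type*} [AddCommGroup U] [Module K U]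

theorem algebraMap_mem_symGr (c : K) : algebraMap K (SymmetricAlgebra K U) c ∈ symGr K U 0 := by
  rw [symGr, pow_zero]
  exact Submodule.algebraMap_mem c

theorem mul_mem_symGr {m n : ℕ} {f g : SymmetricAlgebra K U} (hf : f ∈ symGr K U m)
    (hg : g ∈ symGr K U n) : f * g ∈ symGr K U (m + n) := by
  rw [symGr, pow_add]
  exact Submodule.mul_mem_mul hf hg

theorem ι_mul_mem_symGr {n : ℕ} (u : U) {f : SymmetricAlgebra K U} (hf : f ∈ symGr K U n) :
    SymmetricAlgebra.ι K U u * f ∈ symGr K U (n + 1) := by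
  rw [symGr, pow_succ']
  exact Submodule.mul_mem_mul ⟨u, rfl⟩ hf

theorem ι_pow_mem_symGr (u : U) (n : ℕ) : SymmetricAlgebra.ι K U u ^ n ∈ symGr K U n :=
  Submodule.pow_mem_pow _ (LinearMap.mem_range_self _ u) n

@[elab_as_elim]
theorem symGr_induction {C : ∀ (n : ℕ) (f : SymmetricAlgebra K U), f ∈ symGr K U n → Prop}
    (algebraMap : ∀ c, C 0 (algebraMap K _ c) (algebraMap_mem_symGr c))
    (add : ∀ n f g hf hg, C n f hf → C n g hg → C n (f + g) (add_mem hf hg))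
    (mul : ∀ n u f hf, C n f hf →
      C (n + 1) (SymmetricAlgebra.ι K U u * f) (ι_mul_mem_symGr u hf))
    {n : ℕ} {f : SymmetricAlgebra K U} (hf : f ∈ symGr K U n) : C n f hf := by
  refine Submodule.pow_induction_on_left' _ algebraMap
    (fun f g n hf hg => add n f g hf hg) ?_ hf
  rintro _ ⟨u, rfl⟩ n f hf h
  exact mul n u f hf h

theorem symGr_le_symDegLT {m n : ℕ} (h : m < n) : symGr K U m ≤ symDegLT K U n :=
  le_iSup (fun i : Fin n => symGr K U i) ⟨m, h⟩

theorem symDegLT_le {n : ℕ} {p : Submodule K (SymmetricAlgebra K U)} :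
    symDegLT K U n ≤ p ↔ ∀ m < n, symGr K U m ≤ p :=
  iSup_le_iff.trans ⟨fun h m hm => h ⟨m, hm⟩, fun h i => h i i.2⟩

theorem symDegLT_mono {m n : ℕ} (h : m ≤ n) : symDegLT K U m ≤ symDegLT K U n :=
  symDegLT_le.2 fun _ hi => symGr_le_symDegLT (hi.trans_le h)

@[simp]
theorem symDegLT_zero : symDegLT K U 0 = ⊥ :=
  le_bot_iff.1 (symDegLT_le.2 fun m hm => absurd hm m.not_lt_zero)

theorem mul_mem_symDegLT {m n : ℕ} {f g : SymmetricAlgebra K U} (hf : f ∈ symDegLT K U m)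
    (hg : g ∈ symGr K U n) : f * g ∈ symDegLT K U (m + n) := by
  have h : symDegLT K U m ≤ (symDegLT K U (m + n)).comap (LinearMap.mulRight K g) :=
    symDegLT_le.2 fun i hi a ha => symGr_le_symDegLT (by lia) (mul_mem_symGr ha hg)
  exact h hf

theorem iSup_symGr : ⨆ n, symGr K U n = ⊤ := by
  refine top_unique fun f _ => ?_
  induction f using SymmetricAlgebra.induction with
  | algebraMap c => exact Submodule.mem_iSup_of_mem 0 (algebraMap_mem_symGr c)
  | ι u =>
    refine Submodule.mem_iSup_of_mem 1 ?_
    simpa using ι_pow_mem_symGr (K := K) u 1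
  | add f g hf hg => exact add_mem (hf trivial) (hg trivial)
  | mul f g hf hg =>
    have hfg := Submodule.mul_mem_mul (hf trivial) (hg trivial)
    rw [Submodule.iSup_mul] at hfg
    revert hfg
    refine fun hfg => (iSup_le fun m => ?_ :
      ⨆ m, symGr K U m * ⨆ n, symGr K U n ≤ ⨆ n, symGr K U n) hfg
    rw [Submodule.mul_iSup]
    refine iSup_le fun n => ?_
    rw [symGr, symGr, ← pow_add]
    exact le_iSup (fun n => symGr K U n) (m + n)

instance [FiniteDimensional K U] (n : ℕ) : FiniteDimensional K (symGr K U n) :=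
  Module.Finite.iff_fg.2 (Submodule.FG.pow (Module.Finite.iff_fg.1 inferInstance) n)

/-- The algebra homomorphism `f ↦ ∑ f_n T ^ n`, where `f_n` is the homogeneous component of
degree `n` of `f`. -/
def gradingHom : SymmetricAlgebra K U →ₐ[K] (SymmetricAlgebra K U)[X] :=
  SymmetricAlgebra.lift ((LinearMap.mulRight K X) ∘ₗ
    (Polynomial.CAlgHom (R := K) (A := SymmetricAlgebra K U)).toLinearMap ∘ₗ
      SymmetricAlgebra.ι K U)

theorem gradingHom_ι (u : U) :
    gradingHom (SymmetricAlgebra.ι K U u) = C (SymmetricAlgebra.ι K U u) * X := by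
  simp [gradingHom]

theorem eval_one_gradingHom (f : SymmetricAlgebra K U) : (gradingHom f).eval 1 = f := by
  have h : ((Polynomial.aeval (1 : SymmetricAlgebra K U)).restrictScalars K).comp gradingHom =
      AlgHom.id K (SymmetricAlgebra K U) := by
    apply SymmetricAlgebra.algHom_ext
    ext u
    simp [gradingHom_ι]
  simpa [Polynomial.aeval_def, Polynomial.eval₂_eq_eval_map] using congrArg (fun g => g f) h

theorem gradingHom_of_mem {n : ℕ} {f : SymmetricAlgebra K U} (hf : f ∈ symGr K U n) :
    gradingHom f = C f * X ^ n := by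
  induction hf using symGr_induction with
  | algebraMap c => simp [Polynomial.algebraMap_eq, IsScalarTower.algebraMap_apply K
      (SymmetricAlgebra K U) (SymmetricAlgebra K U)[X]]
  | add n f g _ _ hf hg => simp [hf, hg, add_mul]
  | mul n u f _ hf =>
    rw [map_mul, hf, gradingHom_ι, C_mul]
    ring

theorem coeff_gradingHom_mem (n : ℕ) (f : SymmetricAlgebra K U) :
    (gradingHom f).coeff n ∈ symGr K U n := by
  have hf : f ∈ ⨆ n, symGr K U n := by rw [iSup_symGr]; trivial
  induction hf using Submodule.iSup_induction' with
  | mem m f hf =>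
    rw [gradingHom_of_mem hf, coeff_C_mul_X_pow]
    split_ifs with h
    · exact h ▸ hf
    · exact zero_mem _
  | zero => simp
  | add f g _ _ hf hg => simpa using add_mem hf hg

theorem coeff_zero_gradingHom (f : SymmetricAlgebra K U) :
    (gradingHom f).coeff 0 = algebraMap K _ (algebraMapInv f) := by
  have h : ((Polynomial.aeval (0 : SymmetricAlgebra K U)).restrictScalars K).comp
      (gradingHom (K := K) (U := U)) =
      (Algebra.ofId K (SymmetricAlgebra K U)).comp algebraMapInv := by
    apply SymmetricAlgebra.algHom_ext
    ext u
    simp [gradingHom_ι, algebraMapInv_ι]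
  rw [Polynomial.coeff_zero_eq_eval_zero]
  simpa [Polynomial.aeval_def, Polynomial.eval₂_eq_eval_map, Algebra.ofId_apply] using
    congrArg (fun g => g f) h

theorem dirDeriv_mem_symGr (v : Module.Dual K U) {n : ℕ} {f : SymmetricAlgebra K U}
    (hf : f ∈ symGr K U (n + 1)) : dirDeriv v f ∈ symGr K U n := by
  -- The vanishing in degree 0 is carried through the induction: the Leibniz rule on `u * f` with
  -- `f` constant needs it.
  suffices h : ∀ m (f : SymmetricAlgebra K U), f ∈ symGr K U m →
      (m = 0 → dirDeriv v f = 0) ∧ ∀ n, m = n + 1 → dirDeriv v f ∈ symGr K U n from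
    (h _ f hf).2 n rfl
  intro m f hf
  induction hf using symGr_induction with
  | algebraMap c => simp
  | add n f g _ _ hf hg =>
    refine ⟨fun h => by simp [hf.1 h, hg.1 h], fun m h => ?_⟩
    rw [map_add]
    exact add_mem (hf.2 m h) (hg.2 m h)
  | mul n u f hf ih =>
    refine ⟨by simp, fun m h => ?_⟩
    obtain rfl : n = m := by lia
    rw [Derivation.leibniz, dirDeriv_ι, smul_eq_mul, smul_eq_mul, mul_comm f,
      ← Algebra.smul_def]
    refine add_mem ?_ (Submodule.smul_mem _ _ hf)
    cases n with
    | zero => simp [ih.1 rfl]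
    | succ n => exact ι_mul_mem_symGr u (ih.2 n rfl)

theorem coeff_gradingHom_dirDeriv (v : Module.Dual K U) (n : ℕ) (f : SymmetricAlgebra K U) :
    (gradingHom (dirDeriv v f)).coeff n = dirDeriv v ((gradingHom f).coeff (n + 1)) := by
  have hf : f ∈ ⨆ n, symGr K U n := by rw [iSup_symGr]; trivial
  induction hf using Submodule.iSup_induction' with
  | mem m f hf =>
    rw [gradingHom_of_mem hf]
    cases m with
    | zero =>
      rw [symGr, pow_zero] at hf
      obtain ⟨c, rfl⟩ := Submodule.mem_one.1 hf
      simp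
    | succ m =>
      rw [gradingHom_of_mem (dirDeriv_mem_symGr v hf), coeff_C_mul_X_pow, coeff_C_mul_X_pow]
      simp only [Nat.add_right_cancel_iff]
      split_ifs <;> simp
  | zero => simp
  | add f g _ _ hf hg => simp [hf, hg]

/-- Euler's identity, in the form of a uniqueness statement. -/
theorem eq_zero_of_dirDeriv_eq_zero [CharZero K] [FiniteDimensional K U] {n : ℕ}
    {f : SymmetricAlgebra K U} (hf : f ∈ symGr K U (n + 1)) (h : ∀ v, dirDeriv v f = 0) :
    f = 0 := by
  let b := Module.finBasis K U
  -- The Euler operator: it multiplies the elements of degree `m` by `m`, and `n + 1` is invertible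
  -- in characteristic zero.
  let E : Derivation K (SymmetricAlgebra K U) (SymmetricAlgebra K U) :=
    ∑ i, SymmetricAlgebra.ι K U (b i) • dirDeriv (b.coord i)
  have hE : ∀ g, E g = ∑ i, SymmetricAlgebra.ι K U (b i) * dirDeriv (b.coord i) g := fun g => by
    simp only [E, ← Derivation.coeFnAddMonoidHom_apply, map_sum, Finset.sum_apply]
    rfl
  have hEι : ∀ u, E (SymmetricAlgebra.ι K U u) = SymmetricAlgebra.ι K U u := fun u => by
    conv_rhs => rw [← b.sum_repr u, map_sum]
    simp [hE, dirDeriv_ι, mul_comm, Algebra.smul_def]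
  have key : ∀ m (g : SymmetricAlgebra K U), g ∈ symGr K U m → E g = (m : K) • g := by
    intro m g hg
    induction hg using symGr_induction with
    | algebraMap c => simp
    | add m f g _ _ hf hg => rw [map_add, hf, hg, smul_add]
    | mul m u f _ hf =>
      rw [Derivation.leibniz, hf, hEι, smul_eq_mul, smul_eq_mul, mul_smul_comm]
      push_cast
      rw [add_smul, one_smul, mul_comm f]
  have h0 : E f = 0 := by simp [hE, h]
  rw [key _ f hf] at h0
  exact (smul_eq_zero.1 h0).resolve_left (by exact_mod_cast n.succ_ne_zero)

theorem pairing_dirDeriv (v : Module.Dual K U) (f : SymmetricAlgebra K U)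
    (q : SymmetricAlgebra K (Module.Dual K U)) :
    pairing (dirDeriv v f) q = pairing f (q * SymmetricAlgebra.ι K _ v) := by
  simp [pairing, diffOp_ι]

/-- In characteristic zero, the pairing of `Sym(U)` and `Sym(V)` is nondegenerate. -/
theorem eq_zero_of_pairing_eq_zero [CharZero K] [FiniteDimensional K U]
    {f : SymmetricAlgebra K U} (h : ∀ q, pairing f q = 0) : f = 0 := by
  -- Induction on the degree, for all `f` at once: each `D_v f` is again orthogonal to everything,
  -- so the component of degree `n + 1` of `f` has zero derivatives. The constant component is the
  -- pairing with 1.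
  have key : ∀ n (f : SymmetricAlgebra K U), (∀ q, pairing f q = 0) →
      (gradingHom f).coeff n = 0 := by
    intro n
    induction n with
    | zero =>
      intro f h
      have h1 := h 1
      rw [coeff_zero_gradingHom]
      rw [pairing, map_one, Module.End.one_apply] at h1
      simp [h1]
    | succ n ih =>
      intro f h
      refine eq_zero_of_dirDeriv_eq_zero (coeff_gradingHom_mem _ f) fun v => ?_
      rw [← coeff_gradingHom_dirDeriv]
      exact ih _ fun q => by rw [pairing_dirDeriv, h]
  have h0 : gradingHom f = 0 := Polynomial.ext fun n => by simpa using key n f h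
  rw [← eval_one_gradingHom f, h0, eval_zero]

end Grading

/-! ### Splitting off a line -/

section Splitting

variable {K : Type*} [Field K] {U : Type*} [AddCommGroup U] [Module K U]
  {U' : Type*} [AddCommGroup U'] [Module K U']

/-- A decomposition of `U` as the direct sum of a line spanned by a vector `x` and a copy of
`U'`. -/
structure LineSplitting (K U U' : Type*) [Field K] [AddCommGroup U] [Module K U]
    [AddCommGroup U'] [Module K U'] where
  /-- The vector spanning the line. -/
  vec : U
  /-- The projection along the line. -/
  proj : U →ₗ[K] U'
  /-- The section of the projection. -/
  sec : U' →ₗ[K] U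
  /-- The linear form that is one on the vector and vanishes on the complement. -/
  form : Module.Dual K U
  proj_sec : ∀ w, proj (sec w) = w
  form_sec : ∀ w, form (sec w) = 0
  proj_vec : proj vec = 0
  form_vec : form vec = 1
  sec_proj_add : ∀ u, sec (proj u) + form u • vec = u

/-- The homomorphism of symmetric algebras induced by a linear map. -/
def symMap (φ : U →ₗ[K] U') : SymmetricAlgebra K U →ₐ[K] SymmetricAlgebra K U' :=
  SymmetricAlgebra.lift (SymmetricAlgebra.ι K U' ∘ₗ φ)

@[simp]
theorem symMap_ι (φ : U →ₗ[K] U') (u : U) :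
    symMap φ (SymmetricAlgebra.ι K U u) = SymmetricAlgebra.ι K U' (φ u) := by
  simp [symMap]

theorem symMap_mem_symGr (φ : U →ₗ[K] U') {n : ℕ} {f : SymmetricAlgebra K U}
    (hf : f ∈ symGr K U n) : symMap φ f ∈ symGr K U' n := by
  induction hf using symGr_induction with
  | algebraMap c => rw [AlgHom.commutes]; exact algebraMap_mem_symGr c
  | add n f g _ _ hf hg => rw [map_add]; exact add_mem hf hg
  | mul n u f _ hf => rw [map_mul, symMap_ι]; exact ι_mul_mem_symGr _ hf

theorem symMap_mem_symDegLT (φ : U →ₗ[K] U') {n : ℕ} {f : SymmetricAlgebra K U}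
    (hf : f ∈ symDegLT K U n) : symMap φ f ∈ symDegLT K U' n := by
  have h : symDegLT K U n ≤ (symDegLT K U' n).comap (symMap φ).toLinearMap :=
    symDegLT_le.2 fun i hi a ha => symGr_le_symDegLT hi (symMap_mem_symGr φ ha)
  exact h hf

namespace LineSplitting

variable (S : LineSplitting K U U')

theorem symMap_proj_sec (f : SymmetricAlgebra K U') :
    symMap S.proj (symMap S.sec f) = f := by
  have h : (symMap S.proj).comp (symMap S.sec) = AlgHom.id K _ := by
    apply SymmetricAlgebra.algHom_ext
    ext u
    simp [S.proj_sec]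
  exact congrArg (fun g => g f) h

/-- `Sym(U)` as a polynomial ring over `Sym(U')`. -/
def toPoly : SymmetricAlgebra K U →ₐ[K] (SymmetricAlgebra K U')[X] :=
  SymmetricAlgebra.lift
    ((Polynomial.CAlgHom (R := K) (A := SymmetricAlgebra K U')).toLinearMap ∘ₗ
        SymmetricAlgebra.ι K U' ∘ₗ S.proj +
      S.form.smulRight X)

theorem toPoly_ι (u : U) : S.toPoly (SymmetricAlgebra.ι K U u) =
    C (SymmetricAlgebra.ι K U' (S.proj u)) + S.form u • X := by
  simp [toPoly]

theorem toPoly_vec : S.toPoly (SymmetricAlgebra.ι K U S.vec) = X := by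
  simp [toPoly_ι, S.proj_vec, S.form_vec]

theorem toPoly_symMap_sec (f : SymmetricAlgebra K U') : S.toPoly (symMap S.sec f) = C f := by
  have h : S.toPoly.comp (symMap S.sec) = CAlgHom := by
    apply SymmetricAlgebra.algHom_ext
    ext u : 1
    simp [toPoly_ι, S.proj_sec, S.form_sec]
  exact congrArg (fun g => g f) h

/-- The inverse of `toPoly`. -/
def ofPoly : (SymmetricAlgebra K U')[X] →+* SymmetricAlgebra K U :=
  Polynomial.eval₂RingHom (symMap S.sec).toRingHom (SymmetricAlgebra.ι K U S.vec)

theorem ofPoly_toPoly (f : SymmetricAlgebra K U) : S.ofPoly (S.toPoly f) = f := by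
  induction f using SymmetricAlgebra.induction with
  | algebraMap c =>
    rw [AlgHom.commutes, IsScalarTower.algebraMap_apply K (SymmetricAlgebra K U')]
    simp [ofPoly]
  | ι u =>
    rw [toPoly_ι, 
      ← IsScalarTower.algebraMap_smul (SymmetricAlgebra K U') (S.form u)
        (X : (SymmetricAlgebra K U')[X]), Polynomial.smul_eq_C_mul]
    conv_rhs => rw [← S.sec_proj_add u]
    simp [ofPoly, Algebra.smul_def]
  | add f g hf hg => simp [hf, hg]
  | mul f g hf hg => simp [hf, hg]

theorem eq_sum (f : SymmetricAlgebra K U) :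
    f = ∑ i ∈ (S.toPoly f).support,
      symMap S.sec ((S.toPoly f).coeff i) * SymmetricAlgebra.ι K U S.vec ^ i := by
  conv_lhs => rw [← S.ofPoly_toPoly f]
  simp [ofPoly, Polynomial.eval₂_eq_sum, Polynomial.sum_def]

theorem toPoly_injective : Function.Injective S.toPoly :=
  Function.LeftInverse.injective S.ofPoly_toPoly

/-- The split-off vector has degree one. The case distinction forces the coefficients with `i > n`
to vanish, where truncated `n - i` would allow constants. -/
theorem mem_symGr_iff {n : ℕ} {f : SymmetricAlgebra K U} :
    f ∈ symGr K U n ↔ ∀ i, (S.toPoly f).coeff i ∈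
      if i ≤ n then symGr K U' (n - i) else ⊥ := by
  constructor
  · intro hf
    induction hf using symGr_induction with
    | algebraMap c =>
      intro i
      rw [AlgHom.commutes, IsScalarTower.algebraMap_apply K (SymmetricAlgebra K U'),
        Polynomial.algebraMap_eq, coeff_C]
      rcases i with _ | i
      · simpa using algebraMap_mem_symGr c
      · simp
    | add n f g _ _ hf hg =>
      intro i
      rw [map_add, coeff_add]
      exact add_mem (hf i) (hg i)
    | mul n u f _ hf =>
      intro i
      rw [map_mul, toPoly_ι, add_mul, coeff_add, coeff_C_mul, smul_mul_assoc, coeff_smul]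
      refine add_mem ?_ (Submodule.smul_mem _ _ ?_)
      · have := hf i
        by_cases hi : i ≤ n
        · rw [if_pos hi] at this
          rw [if_pos (by lia), Nat.sub_add_comm hi]
          exact ι_mul_mem_symGr _ this
        · rw [if_neg hi, Submodule.mem_bot] at this
          rw [this, mul_zero]
          exact zero_mem _
      · rcases i with _ | i
        · simp
        · rw [coeff_X_mul]
          simpa using hf i
  · intro h
    rw [S.eq_sum f]
    refine sum_mem fun i _ => ?_
    have := h i
    split_ifs at this with hi
    · rw [← Nat.sub_add_cancel hi]
      exact mul_mem_symGr (symMap_mem_symGr _ this) (ι_pow_mem_symGr _ _)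
    · simp [(Submodule.mem_bot K).1 this]

theorem coeff_toPoly_mem_symDegLT {n : ℕ} {f : SymmetricAlgebra K U}
    (hf : f ∈ symDegLT K U n) (i : ℕ) : (S.toPoly f).coeff i ∈ symDegLT K U' (n - i) := by
  have h : symDegLT K U n ≤ (symDegLT K U' (n - i)).comap
      ((Polynomial.lcoeff (SymmetricAlgebra K U') i).restrictScalars K ∘ₗ
        S.toPoly.toLinearMap) := by
    refine symDegLT_le.2 fun m hm g hg => ?_
    have := S.mem_symGr_iff.1 hg i
    change (S.toPoly g).coeff i ∈ symDegLT K U' (n - i)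
    by_cases hi : i ≤ m
    · rw [if_pos hi] at this
      exact symGr_le_symDegLT (by lia) this
    · rw [if_neg hi, Submodule.mem_bot] at this
      rw [this]
      exact zero_mem _
  exact h hf

end LineSplitting

end Splitting

/-! ### Hilbert series computed from coefficients of powers of the split-off vector. -/

namespace LineSplitting

variable {K : Type*} [Field K] {U : Type*} [AddCommGroup U] [Module K U]
  {U' : Type*} [AddCommGroup U'] [Module K U'] (S : LineSplitting K U U')

/-- The linear map `(a_i)_i ↦ ∑ a_i x ^ i` into `Sym(U)`. -/
def ofCoeffs {N : ℕ} (B : Fin N → Submodule K (SymmetricAlgebra K U')) :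
    (∀ i, B i) →ₗ[K] SymmetricAlgebra K U :=
  ∑ i : Fin N, LinearMap.mulRight K (SymmetricAlgebra.ι K U S.vec ^ (i : ℕ)) ∘ₗ
    (symMap S.sec).toLinearMap ∘ₗ (B i).subtype ∘ₗ LinearMap.proj i

theorem ofCoeffs_apply {N : ℕ} (B : Fin N → Submodule K (SymmetricAlgebra K U'))
    (a : ∀ i, B i) :
    S.ofCoeffs B a = ∑ i, symMap S.sec (a i) * SymmetricAlgebra.ι K U S.vec ^ (i : ℕ) := by
  simp [ofCoeffs]

theorem coeff_toPoly_ofCoeffs {N : ℕ} (B : Fin N → Submodule K (SymmetricAlgebra K U'))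
    (a : ∀ i, B i) (n : ℕ) :
    (S.toPoly (S.ofCoeffs B a)).coeff n =
      if h : n < N then (a ⟨n, h⟩ : SymmetricAlgebra K U') else 0 := by
  simp only [ofCoeffs_apply, map_sum, map_mul, map_pow, toPoly_symMap_sec, toPoly_vec,
    finsetSum_coeff, coeff_C_mul_X_pow]
  split_ifs with h
  · rw [Finset.sum_eq_single ⟨n, h⟩]
    · simp
    · intro i _ hi
      rw [if_neg]
      rintro rfl
      exact hi rfl
    · simp
  · refine Finset.sum_eq_zero fun i _ => if_neg ?_
    have := i.2
    lia

/-- The Hilbert series of a subspace of `Sym(U)` that is the direct sum of the subspaces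
`A_i x ^ i`. -/
theorem hilb_eq_sum [FiniteDimensional K U'] (W : Submodule K (SymmetricAlgebra K U))
    (A : ℕ → Submodule K (SymmetricAlgebra K U')) (N : ℕ) (hA : ∀ i, N ≤ i → A i = ⊥)
    (hW : ∀ g, g ∈ W ↔ ∀ i, (S.toPoly g).coeff i ∈ A i) :
    hilb W = ∑ i ∈ Finset.range N, (PowerSeries.X : PowerSeries ℕ) ^ i * hilb (A i) := by
  ext n
  -- The possible coefficients of `x ^ i` in elements of degree `n` of `W`.
  let B : Fin N → Submodule K (SymmetricAlgebra K U') := fun i =>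
    A i ⊓ if (i : ℕ) ≤ n then symGr K U' (n - i) else ⊥
  have hB : ∀ i, FiniteDimensional K (B i) := by
    intro i
    have : FiniteDimensional K
        (if (i : ℕ) ≤ n then symGr K U' (n - i) else ⊥ :
          Submodule K (SymmetricAlgebra K U')) := by
      by_cases h : (i : ℕ) ≤ n
      · rw [if_pos h]; infer_instance
      · rw [if_neg h]; infer_instance
    exact Submodule.finiteDimensional_of_le inf_le_right
  have hinj : Function.Injective (S.ofCoeffs B) := by
    intro a b hab
    funext i
    have := S.coeff_toPoly_ofCoeffs B a i
    rw [hab, coeff_toPoly_ofCoeffs] at this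
    simpa using this.symm
  have hrange : LinearMap.range (S.ofCoeffs B) = W ⊓ symGr K U n := by
    apply le_antisymm
    · rintro _ ⟨a, rfl⟩
      have h : ∀ i, (S.toPoly (S.ofCoeffs B a)).coeff i ∈
          A i ⊓ if i ≤ n then symGr K U' (n - i) else ⊥ := by
        intro i
        rw [coeff_toPoly_ofCoeffs]
        by_cases hi : i < N
        · rw [dif_pos hi]
          exact (a ⟨i, hi⟩).2
        · rw [dif_neg hi]
          exact zero_mem _
      exact ⟨(hW _).2 fun i => (h i).1, S.mem_symGr_iff.2 fun i => (h i).2⟩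
    · rintro g ⟨h1, h2⟩
      refine ⟨fun i => ⟨(S.toPoly g).coeff i, (hW g).1 h1 i, S.mem_symGr_iff.1 h2 i⟩, ?_⟩
      apply S.toPoly_injective
      ext1 i
      rw [coeff_toPoly_ofCoeffs]
      by_cases hi : i < N
      · rw [dif_pos hi]
      · rw [dif_neg hi]
        have := (hW g).1 h1 i
        rw [hA i (by lia), Submodule.mem_bot] at this
        exact this.symm
  rw [hilb, PowerSeries.coeff_mk, ← hrange, LinearMap.finrank_range_of_inj hinj,
    Module.finrank_pi_fintype, map_sum, Finset.sum_range]
  refine Finset.sum_congr rfl fun i _ => ?_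
  rw [PowerSeries.coeff_X_pow_mul']
  by_cases hi : (i : ℕ) ≤ n
  · rw [if_pos hi, hilb, PowerSeries.coeff_mk]
    have hBi : B i = A i ⊓ symGr K U' (n - i) := congrArg (A i ⊓ ·) (if_pos hi)
    rw [hBi]
  · rw [if_neg hi]
    have hBi : B i = A i ⊓ ⊥ := congrArg (A i ⊓ ·) (if_neg hi)
    rw [hBi, inf_bot_eq, finrank_bot]

end LineSplitting

/-! ### Spaces spanned by multiples of products of vectors -/

section Weighted

variable {K : Type*} [Field K] {U : Type*} [AddCommGroup U] [Module K U]
  {U' : Type*} [AddCommGroup U'] [Module K U'] {ι : Type*}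

/-- The span of the `f p_Y` with `deg f < d(Y)`. -/
def pWeighted (X : ι → U) (d : Finset ι → ℕ) : Submodule K (SymmetricAlgebra K U) :=
  Submodule.span K {g | ∃ (Y : Finset ι) (f : SymmetricAlgebra K U),
    f ∈ symDegLT K U (d Y) ∧ g = f * prodP K X Y}

theorem mul_prodP_mem_pWeighted {X : ι → U} {d : Finset ι → ℕ} {Y : Finset ι}
    {f : SymmetricAlgebra K U} (hf : f ∈ symDegLT K U (d Y)) :
    f * prodP K X Y ∈ pWeighted X d :=
  Submodule.subset_span ⟨Y, f, hf, rfl⟩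

theorem pWeighted_le {X : ι → U} {d : Finset ι → ℕ} {p : Submodule K (SymmetricAlgebra K U)} :
    pWeighted X d ≤ p ↔ ∀ Y, ∀ f ∈ symDegLT K U (d Y), f * prodP K X Y ∈ p := by
  rw [pWeighted, Submodule.span_le]
  constructor
  · intro h Y f hf
    exact h ⟨Y, f, hf, rfl⟩
  · rintro h _ ⟨Y, f, hf, rfl⟩
    exact h Y f hf

theorem pWeighted_mono {X : ι → U} {d d' : Finset ι → ℕ} (h : ∀ Y, d Y ≤ d' Y) :
    pWeighted (K := K) X d ≤ pWeighted X d' :=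
  pWeighted_le.2 fun Y _ hf => mul_prodP_mem_pWeighted (symDegLT_mono (h Y) hf)

theorem pSpace_eq_pWeighted (X : ι → U) (k : ℕ) (J : Set (Set ι)) :
    pSpace K X k J = pWeighted X fun Y => k + chi K X J (Y : Set ι)ᶜ := rfl

/-- The subsequence with the same indices, in the larger index set. -/
def extend {e : ι} (Y : Finset {i // i ≠ e}) : Finset ι :=
  Y.map (Function.Embedding.subtype _)

theorem notMem_extend {e : ι} (Y : Finset {i // i ≠ e}) : e ∉ extend Y := by
  simp [extend]

/-- The subsequence with one more index. -/
def extendCons {e : ι} (Y : Finset {i // i ≠ e}) : Finset ι :=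
  Finset.cons e (extend Y) (notMem_extend Y)

theorem exists_eq_extend (e : ι) (Y : Finset ι) :
    ∃ Y' : Finset {i // i ≠ e}, Y = extend Y' ∨ Y = extendCons Y' := by
  classical
  refine ⟨Y.subtype _, ?_⟩
  by_cases h : e ∈ Y
  · right
    ext i
    by_cases hi : i = e
    · simp [hi, h, extendCons]
    · simp [hi, extendCons, extend]
  · left
    ext i
    by_cases hi : i = e
    · simp [hi, h, extend]
    · simp [hi, extend]

/-! ### Weighted spaces in the presence of a coloop. -/

namespace LineSplitting

variable (S : LineSplitting K U U') {e : ι} {X : ι → U} {X' : {i // i ≠ e} → U'}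

theorem symMap_sec_prodP (hX : ∀ i : {i // i ≠ e}, X i = S.sec (X' i))
    (Y : Finset {i // i ≠ e}) :
    symMap S.sec (prodP K X' Y) = prodP K X (extend Y) := by
  simp [prodP, extend, hX]

theorem prodP_extendCons (he : X e = S.vec) (Y : Finset {i // i ≠ e}) :
    prodP K X (extendCons Y) = SymmetricAlgebra.ι K U S.vec * prodP K X (extend Y) := by
  rw [extendCons, prodP, Finset.prod_cons, he]
  rfl

/-- The coefficients of the powers of the coloop in elements of `pWeighted`. -/
def pWeightedPart (X' : {i // i ≠ e} → U') (d : Finset ι → ℕ) :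
    ℕ → Submodule K (SymmetricAlgebra K U')
  | 0 => pWeighted X' fun Y => d (extend Y)
  | i + 1 => pWeighted X' fun Y => d (extendCons Y) - i

/-- The decomposition of `pWeighted` by powers of the coloop. -/
theorem mem_pWeighted_iff (he : X e = S.vec) (hX : ∀ i : {i // i ≠ e}, X i = S.sec (X' i))
    {d : Finset ι → ℕ} (hd : ∀ Y : Finset {i // i ≠ e}, d (extend Y) ≤ d (extendCons Y) + 1)
    (g : SymmetricAlgebra K U) :
    g ∈ pWeighted X d ↔ ∀ i, (S.toPoly g).coeff i ∈
      pWeightedPart X' d i := by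
  constructor
  · intro hg i
    suffices h : pWeighted X d ≤ Submodule.comap
        ((Polynomial.lcoeff (SymmetricAlgebra K U') i).restrictScalars K ∘ₗ
          S.toPoly.toLinearMap) (pWeightedPart X' d i) from h hg
    refine pWeighted_le.2 fun Y f hf => ?_
    change (S.toPoly (f * prodP K X Y)).coeff i ∈ pWeightedPart X' d i
    obtain ⟨Y, rfl | rfl⟩ := exists_eq_extend e Y
    · rw [← S.symMap_sec_prodP hX, map_mul, toPoly_symMap_sec, coeff_mul_C]
      have := S.coeff_toPoly_mem_symDegLT hf i
      rcases i with _ | i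
      · exact mul_prodP_mem_pWeighted this
      -- The coefficient of `x ^ (i+1)` has degree below `d(Y) - (i+1)`, and `hd` bounds this by
      -- `d(Y ∪ x) - i`.
      · exact mul_prodP_mem_pWeighted (symDegLT_mono (by have := hd Y; lia) this)
    · rw [S.prodP_extendCons he, ← S.symMap_sec_prodP hX, map_mul, map_mul,
        toPoly_symMap_sec, toPoly_vec, ← mul_assoc, coeff_mul_C]
      rcases i with _ | i
      · simp
      · rw [coeff_mul_X]
        exact mul_prodP_mem_pWeighted (S.coeff_toPoly_mem_symDegLT hf i)
  · intro h
    rw [S.eq_sum g]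
    refine sum_mem fun i _ => ?_
    have hi := h i
    generalize (S.toPoly g).coeff i = a at hi
    suffices hle : pWeightedPart X' d i ≤
        (pWeighted X d).comap (LinearMap.mulRight K (SymmetricAlgebra.ι K U S.vec ^ i) ∘ₗ
          (symMap S.sec).toLinearMap) from hle hi
    rcases i with _ | i
    · refine pWeighted_le.2 fun Y f hf => ?_
      change symMap S.sec (f * prodP K X' Y) * _ ^ 0 ∈ pWeighted X d
      rw [pow_zero, mul_one, map_mul, S.symMap_sec_prodP hX]
      exact mul_prodP_mem_pWeighted (symMap_mem_symDegLT _ hf)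
    · refine pWeighted_le.2 fun Y f hf => ?_
      change symMap S.sec (f * prodP K X' Y) * _ ^ (i + 1) ∈ pWeighted X d
      have heq : symMap S.sec (f * prodP K X' Y) * SymmetricAlgebra.ι K U S.vec ^ (i + 1) =
          symMap S.sec f * SymmetricAlgebra.ι K U S.vec ^ i * prodP K X (extendCons Y) := by
        rw [map_mul, S.symMap_sec_prodP hX, S.prodP_extendCons he]
        ring
      rw [heq]
      -- Multiplying by `x ^ i` restores the bound `d(Y ∪ x)` only if the subtraction is not
      -- truncated; otherwise `f = 0`.
      rcases le_total (d (extendCons Y)) i with hdi | hdi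
      · simp only [Nat.sub_eq_zero_of_le hdi, symDegLT_zero, Submodule.mem_bot] at hf
        simp [hf]
      · refine mul_prodP_mem_pWeighted ?_
        have := mul_mem_symDegLT (symMap_mem_symDegLT S.sec hf)
          (ι_pow_mem_symGr (K := K) S.vec i)
        rwa [Nat.sub_add_cancel hdi] at this

/-- Powers of `x` beyond `N` do not occur: the weight `d(Y ∪ x) - j` is zero for `j ≥ N`, which
leaves only `f = 0`. -/
theorem hilb_pWeighted [FiniteDimensional K U'] (he : X e = S.vec)
    (hX : ∀ i : {i // i ≠ e}, X i = S.sec (X' i)) {d : Finset ι → ℕ}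
    (hd : ∀ Y : Finset {i // i ≠ e}, d (extend Y) ≤ d (extendCons Y) + 1) (N : ℕ)
    (hN : ∀ Y : Finset {i // i ≠ e}, d (extendCons Y) ≤ N) :
    hilb (pWeighted (K := K) X d) = hilb (pWeighted (K := K) X' fun Y => d (extend Y)) +
      ∑ j ∈ Finset.range N, (PowerSeries.X : PowerSeries ℕ) ^ (j + 1) *
        hilb (pWeighted (K := K) X' fun Y => d (extendCons Y) - j) := by
  rw [S.hilb_eq_sum _ _ (N + 1) ?_ (S.mem_pWeighted_iff he hX hd), Finset.sum_range_succ',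
    add_comm]
  · simp [pWeightedPart]
  · rintro (_ | i) hi
    · lia
    · refine le_bot_iff.1 (pWeighted_le.2 fun Y f hf => ?_)
      rw [Nat.sub_eq_zero_of_le (by have := hN Y; lia), symDegLT_zero, Submodule.mem_bot] at hf
      simp [hf]

end LineSplitting

end Weighted

/-! ### Flats and contraction of a coloop -/

section Flats

variable {K : Type*} [Field K] {U : Type*} [AddCommGroup U] [Module K U] {ι : Type*}

theorem chi_le_one (X : ι → U) (J : Set (Set ι)) (A : Set ι) : chi K X J A ≤ 1 := by
  unfold chi
  split_ifs <;> simp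

theorem chi_congr {U' : Type*} [AddCommGroup U'] [Module K U'] {κ : Type*} {X : ι → U}
    {J : Set (Set ι)} {A : Set ι} {X' : κ → U'} {J' : Set (Set κ)} {A' : Set κ}
    (h : clos K X A ∈ J ↔ clos K X' A' ∈ J') : chi K X J A = chi K X' J' A' := by
  by_cases h' : clos K X' A' ∈ J'
  · rw [chi, chi, if_pos h', if_pos (h.2 h')]
  · rw [chi, chi, if_neg h', if_neg fun h'' => h' (h.1 h'')]

/-- A linear factor can be moved into the product: `u` is a combination of the vectors outside `Y`,
and multiplying `p_Y` by such a vector gives `p` of a larger subsequence. The cofactor keeps degree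
`m`. -/
theorem prodP_insert_mem {X : ι → U} {m : ℕ} {Y : Finset ι} {f : SymmetricAlgebra K U}
    (hf : f ∈ symGr K U m) (hY : Submodule.span K (X '' (Y : Set ι)ᶜ) = ⊤) (u : U) :
    SymmetricAlgebra.ι K U u * f * prodP K X Y ∈ pWeighted X fun _ => m + 1 := by
  have hu : u ∈ Submodule.span K (X '' (Y : Set ι)ᶜ) := hY ▸ Submodule.mem_top
  induction hu using Submodule.span_induction with
  | mem u hu =>
    obtain ⟨i, hi, rfl⟩ := hu
    have h : SymmetricAlgebra.ι K U (X i) * f * prodP K X Y =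
        f * prodP K X (Finset.cons i Y hi) := by
      rw [prodP, prodP, Finset.prod_cons]
      ring
    rw [h]
    exact mul_prodP_mem_pWeighted (symGr_le_symDegLT m.lt_succ_self hf)
  | zero => simp
  | add u v _ _ hu hv =>
    rw [map_add, add_mul, add_mul]
    exact add_mem hu hv
  | smul c u _ hu =>
    rw [map_smul, smul_mul_assoc, smul_mul_assoc]
    exact Submodule.smul_mem _ _ hu

variable [FiniteDimensional K U]

theorem mem_clos_iff {X : ι → U} {C : Set ι} {i : ι} :
    i ∈ clos K X C ↔ X i ∈ Submodule.span K (X '' C) := by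
  change Module.finrank K (Submodule.span K (X '' insert i C)) =
    Module.finrank K (Submodule.span K (X '' C)) ↔ _
  rw [Set.image_insert_eq]
  constructor
  · intro h
    rw [Submodule.eq_of_le_of_finrank_eq (Submodule.span_mono (Set.subset_insert _ _)) h.symm]
    exact Submodule.subset_span (Set.mem_insert _ _)
  · intro h
    rw [Submodule.span_insert_eq_span h]

theorem clos_univ (X : ι → U) : clos K X Set.univ = Set.univ :=
  Set.eq_univ_of_forall fun i => mem_clos_iff.2 (Submodule.subset_span ⟨i, trivial, rfl⟩)

theorem span_image_eq_top {X : ι → U} (hX : Submodule.span K (Set.range X) = ⊤) {C : Set ι}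
    (hC : clos K X C = Set.univ) : Submodule.span K (X '' C) = ⊤ := by
  refine top_unique (hX ▸ Submodule.span_le.2 ?_)
  rintro _ ⟨i, rfl⟩
  exact mem_clos_iff.1 (hC ▸ Set.mem_univ i)

/-- If `J` has no flat other than the ground set, the bound on the degree can be lowered. -/
theorem pSpace_eq_of_subset {X : ι → U} (hX : Submodule.span K (Set.range X) = ⊤)
    {J : Set (Set ι)} (hJ : J ⊆ {Set.univ}) (m : ℕ) :
    pSpace K X (m + 1) J = pWeighted X fun _ => m + 1 := by
  refine le_antisymm (pWeighted_le.2 fun Y f hf => ?_) (pWeighted_mono fun Y => by simp)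
  by_cases hY : clos K X (Y : Set ι)ᶜ ∈ J
  · have hspan := span_image_eq_top hX (hJ hY)
    rw [chi, if_pos hY] at hf
    suffices h : symDegLT K U (m + 1 + 1) ≤
        (pWeighted X fun _ => m + 1).comap (LinearMap.mulRight K (prodP K X Y)) from h hf
    refine symDegLT_le.2 fun i hi g hg => ?_
    change g * prodP K X Y ∈ pWeighted X fun _ => m + 1
    rcases Nat.lt_succ_iff_lt_or_eq.1 hi with hi | rfl
    · exact mul_prodP_mem_pWeighted (symGr_le_symDegLT hi hg)
    -- Only degree `m + 1` exceeds the lowered bound. Being positive, it leaves a linear factor to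
    -- split off.
    · rw [symGr, pow_succ'] at hg
      induction hg using Submodule.mul_induction_on' with
      | mem_mul_mem u hu f hf =>
        obtain ⟨u, rfl⟩ := hu
        exact prodP_insert_mem hf hspan u
      | add a _ b _ ha hb =>
        rw [add_mul]
        exact add_mem ha hb
  · rw [chi, if_neg hY] at hf
    exact mul_prodP_mem_pWeighted hf

end Flats

/-! ### Index sets and upper sets under contraction. -/

section Contract

variable {ι : Type*} {e : ι}

theorem coe_extend_compl (Y : Finset {i // i ≠ e}) :
    ((extend Y : Finset ι) : Set ι)ᶜ = insert e (Subtype.val '' (Y : Set {i // i ≠ e})ᶜ) := by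
  ext i
  by_cases hi : i = e <;> simp [extend, hi]

theorem coe_extendCons_compl (Y : Finset {i // i ≠ e}) :
    ((extendCons Y : Finset ι) : Set ι)ᶜ = Subtype.val '' (Y : Set {i // i ≠ e})ᶜ := by
  ext i
  by_cases hi : i = e <;> simp [extendCons, extend, hi]

theorem image_val_univ : (Subtype.val '' (Set.univ : Set {i // i ≠ e})) = {e}ᶜ := by
  ext i
  simp

theorem mem_contractJ_iff {J : Set (Set ι)} {D : Set {i // i ≠ e}} :
    D ∈ contractJ J e ↔ insert e (Subtype.val '' D) ∈ J := by
  constructor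
  · rintro ⟨C, hC, he, rfl⟩
    convert hC
    ext i
    by_cases hi : i = e <;> simp [hi, he]
  · intro h
    refine ⟨_, h, Set.mem_insert _ _, ?_⟩
    ext ⟨i, hi⟩
    simp [hi]

theorem mem_contractHatJ_iff {J : Set (Set ι)} {D : Set {i // i ≠ e}} :
    D ∈ contractHatJ J e ↔ Subtype.val '' D ∈ J ∨ D = Set.univ := by
  refine or_congr ⟨?_, fun h => ⟨_, h, by simp, ?_⟩⟩ Iff.rfl
  · rintro ⟨C, hC, he, rfl⟩
    convert hC
    ext i
    by_cases hi : i = e <;> simp [hi, he]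
  · ext i
    simp

end Contract

/-! ### Closure and the indicator of `J` under the splitting. -/

namespace LineSplitting

variable {K : Type*} [Field K] {U : Type*} [AddCommGroup U] [Module K U]
  {U' : Type*} [AddCommGroup U'] [Module K U']
  (S : LineSplitting K U U') {ι : Type*} {e : ι} {X : ι → U} {X' : {i // i ≠ e} → U'}

theorem sec_injective : Function.Injective S.sec :=
  Function.LeftInverse.injective S.proj_sec

theorem image_val (hX : ∀ i : {i // i ≠ e}, X i = S.sec (X' i)) (A : Set {i // i ≠ e}) :
    X '' (Subtype.val '' A) = S.sec '' (X' '' A) := by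
  rw [Set.image_image, Set.image_image]
  exact Set.image_congr fun i _ => hX i

theorem mem_span_insert_vec {M : Set U'} {u : U} :
    u ∈ Submodule.span K (insert S.vec (S.sec '' M)) ↔ S.proj u ∈ Submodule.span K M := by
  constructor
  · intro h
    suffices hle : Submodule.span K (insert S.vec (S.sec '' M)) ≤
        (Submodule.span K M).comap S.proj from hle h
    rw [Submodule.span_le]
    rintro _ (rfl | ⟨w, hw, rfl⟩)
    · change S.proj S.vec ∈ Submodule.span K M
      rw [S.proj_vec]
      exact zero_mem _
    · change S.proj (S.sec w) ∈ Submodule.span K M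
      rw [S.proj_sec]
      exact Submodule.subset_span hw
  · intro h
    rw [← S.sec_proj_add u]
    refine add_mem ?_ (Submodule.smul_mem _ _ (Submodule.subset_span (Set.mem_insert _ _)))
    refine Submodule.span_mono (Set.subset_insert _ _) ?_
    rw [Submodule.span_image]
    exact ⟨_, h, rfl⟩

variable [FiniteDimensional K U] [FiniteDimensional K U']

/-- The span of vectors other than `x` stays in the complement, where `form` vanishes, so it never
reaches `x`. -/
theorem clos_image (he : X e = S.vec) (hX : ∀ i : {i // i ≠ e}, X i = S.sec (X' i))
    (A : Set {i // i ≠ e}) : clos K X (Subtype.val '' A) = Subtype.val '' clos K X' A := by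
  ext i
  rw [mem_clos_iff, S.image_val hX, Submodule.span_image]
  by_cases hi : i = e
  · subst hi
    simp only [Set.mem_image, Subtype.exists, exists_and_right, exists_eq_right, ne_eq,
      not_true_eq_false, IsEmpty.exists_iff, iff_false, he]
    rintro ⟨w, _, hw⟩
    have := S.form_sec w
    rw [hw, S.form_vec] at this
    exact one_ne_zero this
  · rw [show i = (⟨i, hi⟩ : {i // i ≠ e}) from rfl, Subtype.val_injective.mem_set_image,
      mem_clos_iff, hX, Submodule.mem_map]
    exact ⟨fun ⟨w, hw, h⟩ => S.sec_injective h ▸ hw, fun h => ⟨_, h, rfl⟩⟩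

theorem clos_insert (he : X e = S.vec) (hX : ∀ i : {i // i ≠ e}, X i = S.sec (X' i))
    (A : Set {i // i ≠ e}) :
    clos K X (insert e (Subtype.val '' A)) = insert e (Subtype.val '' clos K X' A) := by
  ext i
  rw [mem_clos_iff, Set.image_insert_eq, S.image_val hX, he, S.mem_span_insert_vec]
  by_cases hi : i = e
  · subst hi
    simp [he, S.proj_vec]
  · rw [Set.mem_insert_iff, or_iff_right hi,
      show i = (⟨i, hi⟩ : {i // i ≠ e}) from rfl, Subtype.val_injective.mem_set_image,
      mem_clos_iff, hX, S.proj_sec]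

theorem chi_insert (he : X e = S.vec) (hX : ∀ i : {i // i ≠ e}, X i = S.sec (X' i))
    (J : Set (Set ι)) (A : Set {i // i ≠ e}) :
    chi K X J (insert e (Subtype.val '' A)) = chi K X' (contractJ J e) A := by
  have h : clos K X (insert e (Subtype.val '' A)) ∈ J ↔ clos K X' A ∈ contractJ J e := by
    rw [S.clos_insert he hX, mem_contractJ_iff]
  exact chi_congr h

/-- The ground set adjoined in `contractHatJ` corresponds to the flat `X ∖ x`, which here is already
in `J`. -/
theorem chi_image (he : X e = S.vec) (hX : ∀ i : {i // i ≠ e}, X i = S.sec (X' i))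
    {J : Set (Set ι)} (hJ : ({e}ᶜ : Set ι) ∈ J) (A : Set {i // i ≠ e}) :
    chi K X J (Subtype.val '' A) = chi K X' (contractHatJ J e) A := by
  have h : clos K X' A = Set.univ → Subtype.val '' clos K X' A ∈ J := by
    intro h
    rwa [h, image_val_univ]
  have h' : clos K X (Subtype.val '' A) ∈ J ↔ clos K X' A ∈ contractHatJ J e := by
    rw [S.clos_image he hX, mem_contractHatJ_iff, or_iff_left_of_imp h]
  exact chi_congr h'

theorem compl_mem_flats (he : X e = S.vec) (hX : ∀ i : {i // i ≠ e}, X i = S.sec (X' i)) :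
    ({e}ᶜ : Set ι) ∈ flats K X := by
  change clos K X _ = _
  rw [← image_val_univ, S.clos_image he hX, clos_univ]

/-- Every set avoiding `x` lies below the flat `X ∖ x`, so an upper set that misses this flat misses
them all. -/
theorem image_notMem (he : X e = S.vec) (hX : ∀ i : {i // i ≠ e}, X i = S.sec (X' i))
    {J : Set (Set ι)} (hJ : IsUpperSetOfFlats K X J) (heJ : ({e}ᶜ : Set ι) ∉ J)
    (A : Set {i // i ≠ e}) : Subtype.val '' A ∉ J := fun h =>
  heJ (hJ.upward _ h _ (S.compl_mem_flats he hX) (by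
    rw [← image_val_univ]
    exact Set.image_mono (Set.subset_univ A)))

theorem chi_image_eq_zero (he : X e = S.vec) (hX : ∀ i : {i // i ≠ e}, X i = S.sec (X' i))
    {J : Set (Set ι)} (hJ : IsUpperSetOfFlats K X J) (heJ : ({e}ᶜ : Set ι) ∉ J)
    (A : Set {i // i ≠ e}) : chi K X J (Subtype.val '' A) = 0 := by
  rw [chi, S.clos_image he hX, if_neg (S.image_notMem he hX hJ heJ _)]

theorem hilb_pSpace_of_mem (he : X e = S.vec) (hX : ∀ i : {i // i ≠ e}, X i = S.sec (X' i))
    {J : Set (Set ι)} (heJ : ({e}ᶜ : Set ι) ∈ J) (k : ℕ) :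
    hilb (pSpace K X k J) = hilb (pSpace K X' k (contractJ J e)) +
      ∑ j ∈ Finset.range (k + 1), (PowerSeries.X : PowerSeries ℕ) ^ (j + 1) *
        hilb (pSpace K X' (k - j) (contractHatJ J e)) := by
  rw [pSpace_eq_pWeighted, S.hilb_pWeighted he hX _ (k + 1)]
  · congr 1
    · simp only [coe_extend_compl, S.chi_insert he hX]
      rfl
    · refine Finset.sum_congr rfl fun j hj => ?_
      rw [Finset.mem_range] at hj
      -- This needs `j ≤ k`, which is what the range of summation provides.
      have h : ∀ c, k + c - j = k - j + c := fun c => by lia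
      simp only [coe_extendCons_compl, S.chi_image he hX heJ, h]
      rfl
  · intro Y
    exact Nat.add_le_add_left (chi_le_one _ _ _) _
  · intro Y
    have := chi_le_one (K := K) X J ((extend Y : Finset ι) : Set ι)ᶜ
    lia

theorem hilb_pSpace_of_notMem (he : X e = S.vec)
    (hX : ∀ i : {i // i ≠ e}, X i = S.sec (X' i))
    (hspan : Submodule.span K (Set.range X') = ⊤)
    {J : Set (Set ι)} (hJ : IsUpperSetOfFlats K X J) (heJ : ({e}ᶜ : Set ι) ∉ J) (k : ℕ) :
    hilb (pSpace K X k J) = hilb (pSpace K X' k (contractJ J e)) +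
      ∑ j ∈ Finset.range k, (PowerSeries.X : PowerSeries ℕ) ^ (j + 1) *
        hilb (pSpace K X' (k - j) (contractHatJ J e)) := by
  rw [pSpace_eq_pWeighted, S.hilb_pWeighted he hX _ k]
  · congr 1
    · simp only [coe_extend_compl, S.chi_insert he hX]
      rfl
    · refine Finset.sum_congr rfl fun j hj => ?_
      rw [Finset.mem_range] at hj
      -- The weights here are the constants `k - j ≥ 1`, without a contribution of `chi`; the ground
      -- set alone does not enlarge the corresponding space.
      have hsub : contractHatJ J e ⊆ {Set.univ} := fun D hD =>
        (mem_contractHatJ_iff.1 hD).resolve_left (S.image_notMem he hX hJ heJ D)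
      obtain ⟨m, hm⟩ : ∃ m, k - j = m + 1 := ⟨k - j - 1, by lia⟩
      simp only [coe_extendCons_compl, S.chi_image_eq_zero he hX hJ heJ, add_zero]
      rw [hm, pSpace_eq_of_subset hspan hsub]
  · intro Y
    simp [coe_extendCons_compl, S.chi_image_eq_zero he hX hJ heJ]
  · intro Y
    have := chi_le_one (K := K) X J ((extend Y : Finset ι) : Set ι)ᶜ
    lia

end LineSplitting

/-! ### Kernels of power ideals -/

section Functoriality

variable {K : Type*} [Field K] {U : Type*} [AddCommGroup U] [Module K U]
  {U' : Type*} [AddCommGroup U'] [Module K U'] (φ : U' →ₗ[K] U)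

theorem dirDeriv_symMap (v : Module.Dual K U) (f : SymmetricAlgebra K U') :
    dirDeriv v (symMap φ f) = symMap φ (dirDeriv (φ.dualMap v) f) := by
  induction f using SymmetricAlgebra.induction with
  | algebraMap c => simp
  | ι u => simp [dirDeriv_ι]
  | add f g hf hg => simp [hf, hg]
  | mul f g hf hg => simp [hf, hg]

theorem diffOp_symMap (q : SymmetricAlgebra K (Module.Dual K U)) (f : SymmetricAlgebra K U') :
    diffOp q (symMap φ f) = symMap φ (diffOp (symMap φ.dualMap q) f) := by
  induction q using SymmetricAlgebra.induction generalizing f with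
  | algebraMap c => simp [Module.algebraMap_end_apply]
  | ι v => simpa [diffOp_ι] using dirDeriv_symMap φ v f
  | add p q hp hq => simp [hp, hq]
  | mul p q hp hq => simp [hp, hq]

theorem algebraMapInv_symMap (f : SymmetricAlgebra K U') :
    algebraMapInv (symMap φ f) = algebraMapInv f := by
  have h : (algebraMapInv (R := K) (M := U)).comp (symMap φ) = algebraMapInv := by
    apply SymmetricAlgebra.algHom_ext
    ext u
    simp [algebraMapInv_ι]
  exact congrArg (fun g => g f) h

/-- Adjointness, from the chain rule for linear substitutions; it transports kernels along `φ`. -/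
theorem pairing_symMap (q : SymmetricAlgebra K (Module.Dual K U)) (f : SymmetricAlgebra K U') :
    pairing (symMap φ f) q = pairing f (symMap φ.dualMap q) := by
  rw [pairing, diffOp_symMap, algebraMapInv_symMap, pairing]

end Functoriality

/-! ### Kernels of ideals under the splitting. -/

namespace LineSplitting

variable {K : Type*} [Field K] {U : Type*} [AddCommGroup U] [Module K U]
  {U' : Type*} [AddCommGroup U'] [Module K U'] (S : LineSplitting K U U')

theorem toPoly_dirDeriv_form (f : SymmetricAlgebra K U) :
    S.toPoly (dirDeriv S.form f) = derivative (S.toPoly f) := by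
  induction f using SymmetricAlgebra.induction with
  | algebraMap c =>
    rw [AlgHom.commutes, IsScalarTower.algebraMap_apply K (SymmetricAlgebra K U')
      (SymmetricAlgebra K U')[X]]
    simp
  | ι u =>
    simp [dirDeriv_ι, toPoly_ι, Algebra.algebraMap_eq_smul_one]
  | add f g hf hg => simp [hf, hg]
  | mul f g hf hg =>
    simp [hf, hg]
    ring

/-- `D_form` is differentiation in the variable `x`, and in characteristic zero a polynomial with
zero derivative is constant. -/
theorem exists_eq_symMap_sec [CharZero K] {f : SymmetricAlgebra K U}
    (hf : dirDeriv S.form f = 0) : ∃ g, f = symMap S.sec g := by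
  refine ⟨(S.toPoly f).coeff 0, S.toPoly_injective ?_⟩
  have h : derivative (S.toPoly f) = 0 := by rw [← toPoly_dirDeriv_form, hf, map_zero]
  rw [toPoly_symMap_sec]
  ext1 i
  rcases i with _ | i
  · simp
  · have hi := congrArg (fun p => p.coeff i) h
    simp only [coeff_derivative, coeff_zero] at hi
    have hc : ((i : SymmetricAlgebra K U') + 1) =
        algebraMap K (SymmetricAlgebra K U') ((i + 1 : ℕ) : K) := by simp
    rw [hc, mul_comm, ← Algebra.smul_def] at hi
    rw [(smul_eq_zero.1 hi).resolve_left (by exact_mod_cast i.succ_ne_zero)]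
    simp

theorem symMap_dualMap_surjective : Function.Surjective (symMap S.sec.dualMap) := by
  intro q
  refine ⟨symMap S.proj.dualMap q, ?_⟩
  have h : (symMap S.sec.dualMap).comp (symMap S.proj.dualMap) = AlgHom.id K _ := by
    apply SymmetricAlgebra.algHom_ext
    ext η
    have : S.sec.dualMap (S.proj.dualMap η) = η := by
      ext w
      simp [S.proj_sec]
    simp [this]
  exact congrArg (fun g => g q) h

/-- For `f` in the kernel, `D_form f` pairs to zero with every `q`, since `q * D_form ∈ I`; by
nondegeneracy it vanishes and `f` comes from `Sym(U')`. On such elements the pairing depends only on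
the restriction of operators to `U'`. -/
theorem idealKer_eq_map [CharZero K] [FiniteDimensional K U]
    {I : Ideal (SymmetricAlgebra K (Module.Dual K U))}
    (hI : SymmetricAlgebra.ι K (Module.Dual K U) S.form ∈ I) :
    idealKer I = (idealKer (I.map (symMap S.sec.dualMap))).map (symMap S.sec).toLinearMap := by
  apply le_antisymm
  · intro f hf
    have h0 : dirDeriv S.form f = 0 := eq_zero_of_pairing_eq_zero fun q => by
      rw [pairing_dirDeriv]
      exact hf _ (I.mul_mem_left q hI)
    obtain ⟨g, rfl⟩ := S.exists_eq_symMap_sec h0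
    refine ⟨g, fun q hq => ?_, rfl⟩
    obtain ⟨p, hp, rfl⟩ :=
      (Ideal.mem_map_iff_of_surjective _ S.symMap_dualMap_surjective).1 hq
    rw [← pairing_symMap]
    exact hf p hp
  · rintro _ ⟨g, hg, rfl⟩ q hq
    change pairing (symMap S.sec g) q = 0
    rw [pairing_symMap]
    exact hg _ (Ideal.mem_map_of_mem _ hq)

theorem hilb_map_symMap_sec (W : Submodule K (SymmetricAlgebra K U')) :
    hilb (W.map (symMap S.sec).toLinearMap) = hilb W := by
  ext n
  have hinj : Function.Injective (symMap S.sec).toLinearMap :=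
    Function.LeftInverse.injective S.symMap_proj_sec
  have h : W.map (symMap S.sec).toLinearMap ⊓ symGr K U n =
      (W ⊓ symGr K U' n).map (symMap S.sec).toLinearMap := by
    apply le_antisymm
    · rintro _ ⟨⟨g, hg, rfl⟩, h⟩
      refine ⟨g, ⟨hg, ?_⟩, rfl⟩
      have := symMap_mem_symGr S.proj h
      change symMap S.proj (symMap S.sec g) ∈ _ at this
      rwa [symMap_proj_sec] at this
    · rintro _ ⟨g, ⟨hg, h⟩, rfl⟩
      exact ⟨⟨g, hg, rfl⟩, symMap_mem_symGr _ h⟩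
  rw [hilb, hilb, PowerSeries.coeff_mk, PowerSeries.coeff_mk, h]
  exact (Submodule.equivMapOfInjective _ hinj _).finrank_eq.symm

theorem form_ne_zero : S.form ≠ 0 := by
  intro h
  have := S.form_vec
  simp [h] at this

theorem dualMap_form : S.sec.dualMap S.form = 0 := LinearMap.ext S.form_sec

/-! ### Exponents of the power ideal generators, and the case `k = -1`. -/

section Exponent

variable {ι : Type*} {e : ι} {X : ι → U} {X' : {i // i ≠ e} → U'}

theorem setOf_of_vec (he : X e = S.vec) (hX : ∀ i : {i // i ≠ e}, X i = S.sec (X' i))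
    {η : Module.Dual K U} {P : K → Prop} (h : P (η S.vec)) :
    {i | P (η (X i))} = insert e (Subtype.val '' {i | P (S.sec.dualMap η (X' i))}) := by
  ext i
  by_cases hi : i = e
  · subst hi
    simp [he, h]
  · simp [hi, ← hX ⟨i, hi⟩]

theorem setOf_of_not_vec (he : X e = S.vec) (hX : ∀ i : {i // i ≠ e}, X i = S.sec (X' i))
    {η : Module.Dual K U} {P : K → Prop} (h : ¬P (η S.vec)) :
    {i | P (η (X i))} = Subtype.val '' {i | P (S.sec.dualMap η (X' i))} := by
  ext i
  by_cases hi : i = e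
  · subst hi
    simp [he, h]
  · simp [hi, ← hX ⟨i, hi⟩]

/-- The exponent in the power ideal. -/
def powerExp {V : Type*} [AddCommGroup V] [Module K V] {κ : Type*} (X : κ → V) (k : ℤ)
    (J : Set (Set κ)) (η : Module.Dual K V) : ℕ :=
  (({i | η (X i) ≠ 0}.ncard : ℤ) + k + (chi K X J {i | η (X i) = 0} : ℤ)).toNat

theorem powerExp_of_vec_ne_zero [Finite ι] (he : X e = S.vec)
    (hX : ∀ i : {i // i ≠ e}, X i = S.sec (X' i)) (k : ℤ) (J : Set (Set ι))
    {η : Module.Dual K U} (h : η S.vec ≠ 0) :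
    powerExp X k J η = (({i | S.sec.dualMap η (X' i) ≠ 0}.ncard : ℤ) + 1 + k +
      (chi K X J (Subtype.val '' {i | S.sec.dualMap η (X' i) = 0}) : ℤ)).toNat := by
  rw [powerExp, S.setOf_of_vec (P := (· ≠ 0)) he hX h,
    S.setOf_of_not_vec (P := (· = 0)) he hX h, Set.ncard_insert_of_notMem (by simp),
    Set.ncard_image_of_injective _ Subtype.val_injective]
  push_cast
  rfl

/-- Such an `η` is nonzero only at the coloop among the vectors of `X`, so `m(η) = 1` cancels `k =
-1` and only the indicator of `X ∖ x` remains. -/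
theorem powerExp_of_dualMap_eq_zero [Finite ι] (he : X e = S.vec)
    (hX : ∀ i : {i // i ≠ e}, X i = S.sec (X' i)) (J : Set (Set ι))
    {η : Module.Dual K U} (hη : η ≠ 0) (h : S.sec.dualMap η = 0) :
    powerExp X (-1) J η = chi K X J {e}ᶜ := by
  have hvec : η S.vec ≠ 0 := by
    intro h0
    refine hη (LinearMap.ext fun u => ?_)
    have h1 : η (S.sec (S.proj u)) = 0 := congrArg (fun ξ => ξ (S.proj u)) h
    rw [← S.sec_proj_add u, map_add, map_smul, h0, h1]
    simp
  rw [S.powerExp_of_vec_ne_zero he hX _ J hvec, h, ← image_val_univ]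
  simp

variable [FiniteDimensional K U] [FiniteDimensional K U']

theorem powerExp_of_vec_eq_zero (he : X e = S.vec)
    (hX : ∀ i : {i // i ≠ e}, X i = S.sec (X' i)) (k : ℤ) (J : Set (Set ι))
    {η : Module.Dual K U} (h : η S.vec = 0) :
    powerExp X k J η = powerExp X' k (contractJ J e) (S.sec.dualMap η) := by
  rw [powerExp, powerExp, S.setOf_of_vec (P := (· = 0)) he hX h,
    S.setOf_of_not_vec (P := (· ≠ 0)) he hX (not_not.2 h), S.chi_insert he hX,
    Set.ncard_image_of_injective _ Subtype.val_injective]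

variable [Finite ι]

/-- If `η` does not vanish on `x`, then `x` adds one to `m(η)`, which makes up for a possible drop
of the indicator from 1 to 0. -/
theorem powerExp_le (he : X e = S.vec)
    (hX : ∀ i : {i // i ≠ e}, X i = S.sec (X' i)) (k : ℤ) (J : Set (Set ι))
    (η : Module.Dual K U) :
    powerExp X' k (contractJ J e) (S.sec.dualMap η) ≤ powerExp X k J η := by
  by_cases h : η S.vec = 0
  · exact (S.powerExp_of_vec_eq_zero he hX k J h).ge
  · rw [S.powerExp_of_vec_ne_zero he hX k J h, powerExp]
    have := chi_le_one (K := K) X' (contractJ J e) {i | S.sec.dualMap η (X' i) = 0}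
    exact Int.toNat_le_toNat (by lia)

theorem pow_mem_powerIdeal {V : Type*} [AddCommGroup V] [Module K V] {κ : Type*} {X : κ → V}
    {k : ℤ} {J : Set (Set κ)} {η : Module.Dual K V} (hη : η ≠ 0) :
    SymmetricAlgebra.ι K _ η ^ powerExp X k J η ∈ powerIdeal K X k J :=
  Ideal.subset_span ⟨η, hη, rfl⟩

/-- Restriction to `U'` can only raise a generator to an unnecessarily high power. Conversely, a
form on `U'` extended by zero on `x` keeps its exponent, so every generator for `X/x` is hit. -/
theorem map_powerIdeal (he : X e = S.vec) (hX : ∀ i : {i // i ≠ e}, X i = S.sec (X' i))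
    {J : Set (Set ι)} (hJ : chi K X J {e}ᶜ = 1) :
    (powerIdeal K X (-1) J).map (symMap S.sec.dualMap) =
      powerIdeal K X' (-1) (contractJ J e) := by
  apply le_antisymm
  · rw [Ideal.map_le_iff_le_comap, powerIdeal, Ideal.span_le]
    rintro _ ⟨η, hη, rfl⟩
    change symMap S.sec.dualMap (SymmetricAlgebra.ι K _ η ^ powerExp X (-1) J η) ∈
      powerIdeal K X' (-1) (contractJ J e)
    rw [map_pow, symMap_ι]
    by_cases h : S.sec.dualMap η = 0
    -- The exponent is exactly one, so this generator maps to zero; with exponent zero it would map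
    -- to 1.
    · rw [S.powerExp_of_dualMap_eq_zero he hX J hη h, hJ, h]
      simp
    · exact Ideal.mem_of_dvd _ (pow_dvd_pow _ (S.powerExp_le he hX _ J η))
        (pow_mem_powerIdeal h)
  · refine Ideal.span_le.2 ?_
    rintro _ ⟨η, hη, rfl⟩
    have hsec : S.sec.dualMap (S.proj.dualMap η) = η := by
      ext w
      simp [S.proj_sec]
    have hne : S.proj.dualMap η ≠ 0 := by
      intro h
      rw [h, map_zero] at hsec
      exact hη hsec.symm
    have hvec : S.proj.dualMap η S.vec = 0 := by simp [S.proj_vec]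
    have hmem := Ideal.mem_map_of_mem (symMap S.sec.dualMap)
      (pow_mem_powerIdeal (X := X) (k := -1) (J := J) hne)
    rwa [map_pow, symMap_ι, S.powerExp_of_vec_eq_zero he hX _ J hvec, hsec] at hmem

variable [CharZero K]

theorem hilb_idealKer_of_mem (he : X e = S.vec) (hX : ∀ i : {i // i ≠ e}, X i = S.sec (X' i))
    {J : Set (Set ι)} (heJ : ({e}ᶜ : Set ι) ∈ J) :
    hilb (idealKer (powerIdeal K X (-1) J)) =
      hilb (idealKer (powerIdeal K X' (-1) (contractJ J e))) := by
  have hchi : chi K X J {e}ᶜ = 1 := by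
    rw [chi, if_pos]
    rwa [show clos K X {e}ᶜ = {e}ᶜ from S.compl_mem_flats he hX]
  have hform : SymmetricAlgebra.ι K _ S.form ∈ powerIdeal K X (-1) J := by
    have h := pow_mem_powerIdeal (X := X) (k := -1) (J := J) S.form_ne_zero
    rwa [S.powerExp_of_dualMap_eq_zero he hX J S.form_ne_zero S.dualMap_form, hchi,
      pow_one] at h
  rw [S.idealKer_eq_map hform, hilb_map_symMap_sec, S.map_powerIdeal he hX hchi]

theorem hilb_idealKer_of_notMem (he : X e = S.vec)
    (hX : ∀ i : {i // i ≠ e}, X i = S.sec (X' i))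
    {J : Set (Set ι)} (heJ : ({e}ᶜ : Set ι) ∉ J) :
    hilb (idealKer (powerIdeal K X (-1) J)) = 0 := by
  have hchi : chi K X J {e}ᶜ = 0 := by
    rw [chi, if_neg]
    rwa [show clos K X {e}ᶜ = {e}ᶜ from S.compl_mem_flats he hX]
  have hone : 1 ∈ powerIdeal K X (-1) J := by
    have h := pow_mem_powerIdeal (X := X) (k := -1) (J := J) S.form_ne_zero
    rwa [S.powerExp_of_dualMap_eq_zero he hX J S.form_ne_zero S.dualMap_form, hchi,
      pow_zero] at h
  have hbot : idealKer (powerIdeal K X (-1) J) = ⊥ := by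
    refine le_bot_iff.1 fun f hf => eq_zero_of_pairing_eq_zero fun q => hf q ?_
    rw [(Ideal.eq_top_iff_one _).2 hone]
    trivial
  ext n
  rw [hbot, hilb, PowerSeries.coeff_mk, bot_inf_eq, finrank_bot, map_zero]

end Exponent

end LineSplitting

/-! ### The splitting given by a coloop -/

/-- The coloop is outside the span of the other vectors, since otherwise they would span `U` and the
rank would not drop; a form separates it from that span. -/
theorem IsColoop.exists_form {K : Type*} [Field K] {U : Type*} [AddCommGroup U] [Module K U]
    {ι : Type*} {X : ι → U} (hX : Submodule.span K (Set.range X) = ⊤) {e : ι}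
    (he : IsColoop K X e) :
    ∃ η : Module.Dual K U, η (X e) = 1 ∧ ∀ i ≠ e, η (X i) = 0 := by
  have hmem : X e ∉ Submodule.span K (X '' {e}ᶜ) := by
    intro h
    have htop : Submodule.span K (X '' {e}ᶜ) = ⊤ := by
      refine top_unique (hX ▸ Submodule.span_le.2 ?_)
      rintro _ ⟨i, rfl⟩
      by_cases hi : i = e
      · exact hi ▸ h
      · exact Submodule.subset_span ⟨i, hi, rfl⟩
    rw [IsColoop, rank, htop, finrank_top] at he
    lia
  obtain ⟨η, hη, hle⟩ := Submodule.exists_le_ker_of_notMem hmem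
  refine ⟨(η (X e))⁻¹ • η, by simp [hη], fun i hi => ?_⟩
  have : η (X i) = 0 := hle (Submodule.subset_span ⟨i, hi, rfl⟩)
  simp [this]

/-- The splitting of `U` given by a vector and a linear form that is one on it. -/
def LineSplitting.ofForm {K : Type*} [Field K] {U : Type*} [AddCommGroup U] [Module K U] (x : U)
    (η : Module.Dual K U) (h : η x = 1) : LineSplitting K U (U ⧸ Submodule.span K {x}) where
  vec := x
  proj := Submodule.mkQ _
  -- The projection `u ↦ u - η(u) x` onto `ker η` kills `x`, hence descends to the quotient.
  sec := Submodule.liftQ _ (LinearMap.id - η.smulRight x) (by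
    rw [Submodule.span_le, Set.singleton_subset_iff]
    simp [h])
  form := η
  proj_sec w := by
    obtain ⟨u, rfl⟩ := Submodule.mkQ_surjective _ w
    have hx : Submodule.mkQ (Submodule.span K {x}) x = 0 :=
      (Submodule.Quotient.mk_eq_zero _).2 (Submodule.mem_span_singleton_self x)
    change Submodule.mkQ _ (u - η u • x) = _
    rw [map_sub, map_smul, hx, smul_zero, sub_zero]
  form_sec w := by
    obtain ⟨u, rfl⟩ := Submodule.mkQ_surjective _ w
    simp [h]
  proj_vec := (Submodule.Quotient.mk_eq_zero _).2 (Submodule.mem_span_singleton_self x)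
  form_vec := h
  sec_proj_add u := by simp

end Zonotopal

end

theorem mainTheorem6 {K : Type*} [Field K] [CharZero K]
    {U : Type*} [AddCommGroup U] [Module K U] [FiniteDimensional K U]
    {ι : Type*} [Finite ι] (X : ι → U) (hX : Submodule.span K (Set.range X) = ⊤)
    (J : Set (Set ι)) (hJ : Zonotopal.IsUpperSetOfFlats K X J) (hJne : J.Nonempty)
    (e : ι) (he : Zonotopal.IsColoop K X e) :
    (∀ k : ℕ,
      (({e}ᶜ : Set ι) ∈ J →
        Zonotopal.hilb (Zonotopal.pSpace K X k J) =
          Zonotopal.hilb (Zonotopal.pSpace K (Zonotopal.contract K X e) k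
              (Zonotopal.contractJ J e)) +
            ∑ j ∈ Finset.range (k + 1), (PowerSeries.X : PowerSeries ℕ) ^ (j + 1) *
              Zonotopal.hilb (Zonotopal.pSpace K (Zonotopal.contract K X e) (k - j)
                (Zonotopal.contractHatJ J e))) ∧
      (({e}ᶜ : Set ι) ∉ J →
        Zonotopal.hilb (Zonotopal.pSpace K X k J) =
          Zonotopal.hilb (Zonotopal.pSpace K (Zonotopal.contract K X e) k
              (Zonotopal.contractJ J e)) +
            ∑ j ∈ Finset.range k, (PowerSeries.X : PowerSeries ℕ) ^ (j + 1) *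
              Zonotopal.hilb (Zonotopal.pSpace K (Zonotopal.contract K X e) (k - j)
                (Zonotopal.contractHatJ J e)))) ∧
    (({e}ᶜ : Set ι) ∈ J →
      Zonotopal.hilb (Zonotopal.idealKer (Zonotopal.powerIdeal K X (-1) J)) =
        Zonotopal.hilb (Zonotopal.idealKer (Zonotopal.powerIdeal K
          (Zonotopal.contract K X e) (-1) (Zonotopal.contractJ J e)))) ∧
    (({e}ᶜ : Set ι) ∉ J →
      Zonotopal.hilb (Zonotopal.idealKer (Zonotopal.powerIdeal K X (-1) J)) = 0) := by
  obtain ⟨η, hη, hη0⟩ := he.exists_form hX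
  let S := Zonotopal.LineSplitting.ofForm (X e) η hη
  have hvec : X e = S.vec := rfl
  -- Since `η` vanishes on `X i`, the section returns `X i` itself rather than a translate by a
  -- multiple of `x`.
  have hsec : ∀ i : {i // i ≠ e}, X i = S.sec (Zonotopal.contract K X e i) := fun i => by
    simp [S, Zonotopal.LineSplitting.ofForm, Zonotopal.contract, hη0 i i.2]
  have hspan : Submodule.span K (Set.range (Zonotopal.contract K X e)) = ⊤ := by
    refine top_unique fun w _ => ?_
    obtain ⟨u, rfl⟩ := Submodule.mkQ_surjective _ w
    have hu : u ∈ Submodule.span K (Set.range X) := hX ▸ Submodule.mem_top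
    suffices hle : Submodule.span K (Set.range X) ≤
        (Submodule.span K (Set.range (Zonotopal.contract K X e))).comap
          (Submodule.mkQ (Submodule.span K {X e})) from hle hu
    rw [Submodule.span_le]
    rintro _ ⟨i, rfl⟩
    by_cases hi : i = e
    · subst hi
      have h0 : Submodule.mkQ (Submodule.span K {X i}) (X i) = 0 := S.proj_vec
      change Submodule.mkQ (Submodule.span K {X i}) (X i) ∈
        Submodule.span K (Set.range (Zonotopal.contract K X i))
      rw [h0]
      exact zero_mem _
    · exact Submodule.subset_span ⟨⟨i, hi⟩, rfl⟩
  exact ⟨fun k => ⟨fun h => S.hilb_pSpace_of_mem hvec hsec h k,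
    fun h => S.hilb_pSpace_of_notMem hvec hsec hspan hJ h k⟩,
    fun h => S.hilb_idealKer_of_mem hvec hsec h,
    fun h => S.hilb_idealKer_of_notMem hvec hsec h⟩
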